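/- **Setting.** Fix a finite set $\mathcal M$ of modalities with raw feature dimensions $\delta_t$ ($t\in\mathcal M$), a common latent dimension $d$, a number $L$ of layers and a number $k$ of weight matrices per layer. A network parameter is a tuple $\theta=(W_{\mathrm{in}},(W^{(l)}_r)_{l\le L,\,r\le k},(W^{(l)}_0)_{l\le L},\psi)$ with $W_{\mathrm{in}}\in\mathbb R^{(\sum_t\delta_t)\times |\mathcal M|d}$, $W^{(l)}_r,W^{(l)}_0\in\mathbb R^{|\mathcal M|d\times|\mathcal M|d}$, and $\psi$ in a measurable space of remaining parameters (attention, biases, readout). $\Theta_{\mathrm{GNN}}$ is the set of all such tuples; $\Theta_{\mathrm{NSG}}$ is the set of those tuples in which every one of these matrices is block diagonal with one block per modality (for two modalities, $W=\begin{bmatrix}W_1&0\\0&W_2\end{bmatrix}$). A *general GNN* computes, from a graph $G$ on a vertex set $V$ and concatenated features $X=[X_t]_{t\in\mathcal M}$, the embeddings $E=XW_{\mathrm{in}}$, $H^{(0)}=E$, and in layer $l$ a new embedding of each node $v$ that is an arbitrary function (depending on $\psi,l,G,v$) of the rows of $H^{(l-1)}W^{(l)}_r$ in the closed neighbourhood of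 $v$ and of the row of $EW^{(l)}_0$ at $v$, followed by a nodewise readout. An *NSG network* (Node Splitting Graph network) has parameters in $\Theta_{\mathrm{NSG}}$; it does the same message passing on the node splitting graph, whose vertices are the pairs $\langle v,t\rangle$ (node, modality), where the sub-nodes of one node are joined by intra-node edges (the complete graph, or a sparser graph) and, for each edge $uv$ of $G$, sub-nodes of $u$ and $v$ are joined by self-type edges $\langle u,t\rangle\langle v,t\rangle$, by cross-type edges, or by both; finally the sub-node embeddings of each node are concatenated and read out. (Cross-type edges join $\langle u,i\rangle$ and $\langle v,j\rangle$ when $ij$ is an intra-node edge of $u$ or of $v$, i.e. for all $i\ne j$ when the intra-node graphs are complete.) Let $D$ be a probability distribution on $\mathcal X\times\mathcal Y$, let $S=(s_1,\dots,s_n)$, $n\ge1$, be i.i.d. from $D$, and let $L(f,x,y)$ be a real loss such that, for the given GNN and NSG architectures, $L(f_\theta,x,y)$ is jointly measurable in $(\theta,x,y)$. Put $R(f)=\mathbb E_{(x,y)\sim D}L(f,x,y)$ and $\hat R_S(f)=\frac1n\sum_iL(f,x_i,y_i)$ where $s_i=(x_i,y_i)$. Let $\sigma>0$ be such that for every GNN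 parameter $\theta\in\Theta_{\mathrm{GNN}}$ and every NSG parameter $\theta\in\Theta_{\mathrm{NSG}}$ the loss $L(f_\theta,x,y)$ of the respective network is $\sigma$-sub-Gaussian under $D$, i.e. $\mathbb E_D\,e^{\lambda(L(f_\theta,x,y)-R(f_\theta))}\le e^{\lambda^2\sigma^2/2}$ for all $\lambda\in\mathbb R$. Learned parameters are random variables on the same probability space as $S$, and $I(\cdot\,;\cdot)\in[0,\infty]$ is mutual information. **Claim.** 1. $\Theta_{\mathrm{NSG}}\subseteq\Theta_{\mathrm{GNN}}$, and there is a measurable map $T:\Theta_{\mathrm{GNN}}\to\Theta_{\mathrm{NSG}}$ with $T(w)=w$ for all $w\in\Theta_{\mathrm{NSG}}$. In particular every random NSG parameter $W_{\mathrm{NSG}}$ is of the form $T(W_{\mathrm{GNN}})$ for some random GNN parameter $W_{\mathrm{GNN}}$. 2. Let $W_{\mathrm{GNN}}$ be any random element of $\Theta_{\mathrm{GNN}}$, $T:\Theta_{\mathrm{GNN}}\to\Theta_{\mathrm{NSG}}$ any measurable map, and $W_{\mathrm{NSG}}=T(W_{\mathrm{GNN}})$. Then $S\to W_{\mathrm{GNN}}\to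 W_{\mathrm{NSG}}$ is a Markov chain ($S$ and $W_{\mathrm{NSG}}$ are conditionally independent given $W_{\mathrm{GNN}}$), and $$I(S;W_{\mathrm{NSG}})\le I(S;W_{\mathrm{GNN}}).$$ For each of the two models (write $W$ for its parameter and $f_W$ for its network), $\hat R_S(f_W)-R(f_W)$ is integrable if $I(S;W)<\infty$, and the expected generalization gap satisfies $$\bigl|\mathbb E[\hat R_S(f_W)-R(f_W)]\bigr|\le\sqrt{\tfrac{2\sigma^2}{n}I(S;W)}$$ (the right-hand side being $+\infty$ if $I(S;W)=\infty$). The bound for NSG is no larger than the bound for the GNN: $$\sqrt{\tfrac{2\sigma^2}{n}I(S;W_{\mathrm{NSG}})}\le\sqrt{\tfrac{2\sigma^2}{n}I(S;W_{\mathrm{GNN}})}.$$ -/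

import Mathlib

open MeasureTheory ProbabilityTheory InformationTheory
open scoped ENNReal NNReal

noncomputable section

/-! ### Block weights and parameter spaces -/

/-- Real matrices carry the product (equivalently, Borel) σ-algebra on their entries. -/
instance Matrix.instMeasurableSpaceReal {m n : Type*} : MeasurableSpace (Matrix m n ℝ) :=
  inferInstanceAs (MeasurableSpace (m → n → ℝ))

/-- Column index of the concatenated raw features `[X_1 … X_m]`; modality `t` has dimension
`δ t`. -/
abbrev RawIdx (M : Type*) (δ : M → ℕ) := (t : M) × Fin (δ t)

/-- Column index of the concatenated latent embeddings `[E_1 … E_m]`, each of dimension `d`. -/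
abbrev HidIdx (M : Type*) (d : ℕ) := (_ : M) × Fin d

/-- Parameters of an `L`-layer graph network acting on concatenated multimodal embeddings:
the input projection, `k` weight matrices per layer applied to the previous embeddings
(for instance one per relation), one residual weight matrix per layer applied to the initial
embeddings, and all remaining parameters `Ψ` (attention, biases, readout, ...). -/
abbrev NetParam (M : Type*) (δ : M → ℕ) (d L k : ℕ) (Ψ : Type*) :=
  Matrix (RawIdx M δ) (HidIdx M d) ℝ ×
    (Fin L → Fin k → Matrix (HidIdx M d) (HidIdx M d) ℝ) ×
    (Fin L → Matrix (HidIdx M d) (HidIdx M d) ℝ) × Ψ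

/-- `Θ_GNN`: the weight matrices of a general GNN are unrestricted. -/
def gnnParamSpace (M : Type*) (δ : M → ℕ) (d L k : ℕ) (Ψ : Type*) :
    Set (NetParam M δ d L k Ψ) := Set.univ

/-- `Θ_NSG`: every weight matrix is block diagonal, with one block per modality. -/
def nsgParamSpace (M : Type*) [DecidableEq M] (δ : M → ℕ) (d L k : ℕ) (Ψ : Type*) :
    Set (NetParam M δ d L k Ψ) :=
  {θ | (∃ B : (t : M) → Matrix (Fin (δ t)) (Fin d) ℝ, θ.1 = Matrix.blockDiagonal' B) ∧
    (∀ l r, ∃ B : M → Matrix (Fin d) (Fin d) ℝ, θ.2.1 l r = Matrix.blockDiagonal' B) ∧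
    (∀ l, ∃ B : M → Matrix (Fin d) (Fin d) ℝ, θ.2.2.1 l = Matrix.blockDiagonal' B)}

/-! ### General message-passing networks -/

/-- A predictor maps a graph and its concatenated raw features to node outputs. -/
abbrev Predictor (V M : Type*) (δ : M → ℕ) (o : ℕ) :=
  SimpleGraph V → Matrix V (RawIdx M δ) ℝ → V → Fin o → ℝ

/-- The choices defining a message-passing network on the original graph. In each layer the new
embedding of `v` is an arbitrary function of the linearly transformed embeddings of the closed
neighbourhood of `v` and of the linearly transformed initial embedding of `v`
(so any propagation matrix, attention, aggregation and activation is allowed). -/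
structure GNNArch (V M : Type*) (d L k o : ℕ) (Ψ : Type*) where
  update : Ψ → Fin L → (G : SimpleGraph V) → (v : V) →
    (Fin k → {u : V // u = v ∨ G.Adj v u} → HidIdx M d → ℝ) →
    (HidIdx M d → ℝ) → HidIdx M d → ℝ
  readout : Ψ → (HidIdx M d → ℝ) → Fin o → ℝ

/-- The function computed by the network with parameters `θ`: `E = X W_in`, `H⁰ = E`, layers
`Hˡ_v = update ((Hˡ⁻¹ Wˡ_r)_u, u ∈ N[v], r; (E W₀ˡ)_v)`, followed by a nodewise readout. -/
def GNNArch.predict {V M : Type*} [Fintype M] {δ : M → ℕ} {d L k o : ℕ} {Ψ : Type*}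
    (A : GNNArch V M d L k o Ψ) (θ : NetParam M δ d L k Ψ) : Predictor V M δ o :=
  fun G X v =>
    let E : Matrix V (HidIdx M d) ℝ := X * θ.1
    let H : Matrix V (HidIdx M d) ℝ := (List.finRange L).foldl
      (fun H l => Matrix.of fun v =>
        A.update θ.2.2.2 l G v (fun r u => (H * θ.2.1 l r) u.1) ((E * θ.2.2.1 l) v)) E
    A.readout θ.2.2.2 (H v)

/-! ### Node splitting graphs -/

/-- Which inter-node edges the node splitting graph contains. -/
inductive InterEdges
  | selfType
  | crossType
  | hybrid

/-- The node splitting graph of `G`: vertices `⟨v, i⟩` with `v` a node and `i` a modality. The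
sub-nodes of `v` are joined by intra-node edges according to `C v` (the complete graph on the
modalities, or a spanning tree in the sparsified version). For an edge `uv` of `G`, self-type
edges join `⟨u, i⟩` and `⟨v, i⟩`, and cross-type edges join `⟨u, i⟩` and `⟨v, j⟩` if `ij` is an
intra-node edge of `u` or of `v` (that is, if `i ≠ j`, when the `C v` are complete). -/
def nodeSplitGraph {V M : Type*} (κ : InterEdges) (C : V → SimpleGraph M)
    (G : SimpleGraph V) : SimpleGraph (V × M) where
  Adj p q := (p.1 = q.1 ∧ (C p.1).Adj p.2 q.2) ∨
    (G.Adj p.1 q.1 ∧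
      match κ with
      | .selfType => p.2 = q.2
      | .crossType => (C p.1).Adj p.2 q.2 ∨ (C q.1).Adj p.2 q.2
      | .hybrid => p.2 = q.2 ∨ (C p.1).Adj p.2 q.2 ∨ (C q.1).Adj p.2 q.2)
  symm := ⟨by
    rintro ⟨u, i⟩ ⟨v, j⟩ h
    rcases h with ⟨rfl, h⟩ | ⟨h, h'⟩
    · exact Or.inl ⟨rfl, h.symm⟩
    · refine Or.inr ⟨h.symm, ?_⟩
      cases κ <;> simp_all only [SimpleGraph.adj_comm] <;> tauto⟩
  loopless := ⟨by
    rintro ⟨u, i⟩ h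
    rcases h with ⟨_, h⟩ | ⟨h, _⟩
    · exact h.ne rfl
    · exact h.ne rfl⟩

/-- The choices defining an NSG network: the kind of inter-node edges, the intra-node edges
(which may depend on the graph and on the embeddings), heterogeneous message passing between
sub-nodes of the node splitting graph, and the readout applied to the merged embeddings. -/
structure NSGArch (V M : Type*) (d L k o : ℕ) (Ψ : Type*) where
  inter : InterEdges
  intra : SimpleGraph V → Matrix V (HidIdx M d) ℝ → V → SimpleGraph M
  update : Ψ → Fin L → (Gs : SimpleGraph (V × M)) → (p : V × M) →
    (Fin k → {q : V × M // q = p ∨ Gs.Adj p q} → Fin d → ℝ) →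
    (Fin d → ℝ) → Fin d → ℝ
  readout : Ψ → (HidIdx M d → ℝ) → Fin o → ℝ

/-- The function computed by the NSG network with parameters `θ`. Row `v` of `H` is the
concatenation of the embeddings of the sub-nodes `⟨v, t⟩`, and the part `⟨s, ·⟩` of row `u` of
`H W` is the transformed embedding of `⟨u, s⟩`; it equals `H_s W_s` when `W` is block diagonal
with blocks `W_s`. -/
def NSGArch.predict {V M : Type*} [Fintype M] {δ : M → ℕ} {d L k o : ℕ} {Ψ : Type*}
    (A : NSGArch V M d L k o Ψ) (θ : NetParam M δ d L k Ψ) : Predictor V M δ o :=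
  fun G X v =>
    let E : Matrix V (HidIdx M d) ℝ := X * θ.1
    let Gs : SimpleGraph (V × M) := nodeSplitGraph A.inter (A.intra G E) G
    let H : Matrix V (HidIdx M d) ℝ := (List.finRange L).foldl
      (fun H l => Matrix.of fun v c =>
        A.update θ.2.2.2 l Gs (v, c.1)
          (fun r q j => (H * θ.2.1 l r) q.1.1 ⟨q.1.2, j⟩)
          (fun j => (E * θ.2.2.1 l) v ⟨c.1, j⟩) c.2) E
    A.readout θ.2.2.2 (H v)

/-! ### Risk and information -/

/-- `R(f) = E_{(x, y) ∼ D} L(f, x, y)`. -/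
def risk {F 𝒳 𝒴 : Type*} [MeasurableSpace 𝒳] [MeasurableSpace 𝒴]
    (loss : F → 𝒳 → 𝒴 → ℝ) (D : Measure (𝒳 × 𝒴)) (f : F) : ℝ :=
  ∫ z, loss f z.1 z.2 ∂D

/-- The empirical loss over the sample `s = (s_1, …, s_n)`. -/
def empRisk {F 𝒳 𝒴 : Type*} {n : ℕ} (loss : F → 𝒳 → 𝒴 → ℝ) (s : Fin n → 𝒳 × 𝒴) (f : F) : ℝ :=
  (∑ i, loss f (s i).1 (s i).2) / n

/-- Mutual information `I(X; Y)`, with values in `[0, ∞]`. -/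
def mutualInfo {Ω α β : Type*} [MeasurableSpace Ω] [MeasurableSpace α] [MeasurableSpace β]
    (μ : Measure Ω) (X : Ω → α) (Y : Ω → β) : ℝ≥0∞ :=
  klDiv (μ.map fun ω => (X ω, Y ω)) ((μ.map X).prod (μ.map Y))

/-- `X → Y → Z` is a Markov chain: `X` and `Z` are conditionally independent given `Y`. -/
def IsMarkovChain {Ω α β γ : Type*} [MeasurableSpace Ω] [MeasurableSpace α]
    [mβ : MeasurableSpace β] [MeasurableSpace γ]
    (μ : Measure Ω) (X : Ω → α) (Y : Ω → β) (Z : Ω → γ) : Prop :=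
  ∀ (A : Set α) (B : Set γ), MeasurableSet A → MeasurableSet B →
    μ⟦X ⁻¹' A ∩ Z ⁻¹' B | mβ.comap Y⟧ =ᵐ[μ]
      μ⟦X ⁻¹' A | mβ.comap Y⟧ * μ⟦Z ⁻¹' B | mβ.comap Y⟧

/-- The bound `√(2σ² I / n)`, with values in `[0, ∞]`. -/
def infoBound (σ : ℝ≥0) (n : ℕ) (I : ℝ≥0∞) : ℝ≥0∞ :=
  (((2 * σ ^ 2 / n : ℝ≥0) : ℝ≥0∞) * I) ^ (1 / 2 : ℝ)

end

/-! ### Block diagonal projection of the parameters -/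

/-! Deleting the off-diagonal blocks is a measurable retraction of the unrestricted parameters onto
the block diagonal ones. Any `T ∘ W` is a function of `W`, which gives the Markov chain, and the
pair `(S, T ∘ W)` and the product of its marginals are pushforwards under `Prod.map id T`, so
monotonicity of `klDiv` under maps gives data processing (`mutualInfo_comp_right_le`).

The gap bound is a change of measure from the product of the marginals to the joint law of `(S, W)`.
Under the product law, fixing the parameter leaves a centred average of `n` i.i.d. sub-Gaussian
losses, so the gap has variance proxy `σ² / n` (`hasSubgaussianMGF_empRisk_sub_risk`).
Donsker–Varadhan applied to every multiple `t` of the gap, then optimised over `t`, bounds its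
squared mean under the joint law by `2 (σ² / n) I` (`sq_integral_le_klDiv`). The network
architecture plays no role beyond measurability and sub-Gaussianity of the loss. -/

/-- Setting the entries outside the diagonal blocks to zero is measurable. -/
lemma Matrix.measurable_blockDiagonal'_blockDiag' {M : Type*} [DecidableEq M] {p q : M → Type*} :
    Measurable fun W : Matrix ((t : M) × p t) ((t : M) × q t) ℝ =>
      Matrix.blockDiagonal' (Matrix.blockDiag' W) := by
  refine measurable_pi_lambda _ fun i => measurable_pi_lambda _ fun j => ?_
  obtain ⟨s, i⟩ := i
  obtain ⟨t, j⟩ := j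
  have hentry (a : (t : M) × p t) (b : (t : M) × q t) :
      Measurable fun W : Matrix ((t : M) × p t) ((t : M) × q t) ℝ => W a b :=
    (measurable_pi_apply b).comp (measurable_pi_apply a)
  by_cases h : s = t
  · subst h
    simpa only [Matrix.blockDiagonal'_apply_eq, Matrix.blockDiag'_apply] using hentry ⟨s, i⟩ ⟨s, j⟩
  · simpa only [Matrix.blockDiagonal'_apply_ne _ _ _ h] using measurable_const

/-- The projection `Θ_GNN → Θ_NSG` keeping only the diagonal blocks of every weight matrix. -/
def blockProjection (M : Type*) [DecidableEq M] (δ : M → ℕ) (d L k : ℕ) (Ψ : Type*)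
    (θ : gnnParamSpace M δ d L k Ψ) : nsgParamSpace M δ d L k Ψ :=
  ⟨(Matrix.blockDiagonal' (Matrix.blockDiag' θ.1.1),
    fun l r => Matrix.blockDiagonal' (Matrix.blockDiag' (θ.1.2.1 l r)),
    fun l => Matrix.blockDiagonal' (Matrix.blockDiag' (θ.1.2.2.1 l)), θ.1.2.2.2),
    ⟨_, rfl⟩, fun _ _ => ⟨_, rfl⟩, fun _ => ⟨_, rfl⟩⟩

lemma measurable_blockProjection (M : Type*) [DecidableEq M] (δ : M → ℕ) (d L k : ℕ) (Ψ : Type*)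
    [MeasurableSpace Ψ] : Measurable (blockProjection M δ d L k Ψ) := by
  have hval : Measurable fun θ : gnnParamSpace M δ d L k Ψ => θ.1 := measurable_subtype_coe
  have h1 := hval.snd.fst
  have h2 := hval.snd.snd.fst
  refine Measurable.subtype_mk (Measurable.prodMk ?_ (Measurable.prodMk ?_ (Measurable.prodMk ?_ ?_)))
  · exact Matrix.measurable_blockDiagonal'_blockDiag'.comp hval.fst
  · exact measurable_pi_lambda _ fun l => measurable_pi_lambda _ fun r =>
      Matrix.measurable_blockDiagonal'_blockDiag'.comp
        ((measurable_pi_apply r).comp ((measurable_pi_apply l).comp h1))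
  · exact measurable_pi_lambda _ fun l =>
      Matrix.measurable_blockDiagonal'_blockDiag'.comp ((measurable_pi_apply l).comp h2)
  · exact hval.snd.snd.snd

lemma blockProjection_inclusion {M : Type*} [DecidableEq M] {δ : M → ℕ} {d L k : ℕ} {Ψ : Type*}
    (h : nsgParamSpace M δ d L k Ψ ⊆ gnnParamSpace M δ d L k Ψ) (w : nsgParamSpace M δ d L k Ψ) :
    blockProjection M δ d L k Ψ (Set.inclusion h w) = w := by
  obtain ⟨⟨W, U, U₀, ψ⟩, hW, hU, hU₀⟩ := w
  refine Subtype.ext (Prod.ext ?_ (Prod.ext ?_ (Prod.ext ?_ rfl)))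
  · obtain ⟨B, hB⟩ := hW
    change Matrix.blockDiagonal' (Matrix.blockDiag' W) = W
    rw [show W = _ from hB, Matrix.blockDiag'_blockDiagonal']
  · funext l r
    obtain ⟨B, hB⟩ := hU l r
    change Matrix.blockDiagonal' (Matrix.blockDiag' (U l r)) = U l r
    rw [show U l r = _ from hB, Matrix.blockDiag'_blockDiagonal']
  · funext l
    obtain ⟨B, hB⟩ := hU₀ l
    change Matrix.blockDiagonal' (Matrix.blockDiag' (U₀ l)) = U₀ l
    rw [show U₀ l = _ from hB, Matrix.blockDiag'_blockDiagonal']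

/-! ### Markov chains and data processing -/

/-- An event determined by `T ∘ Y` is already measurable for the σ-algebra of `Y`, so its indicator
pulls out of the conditional expectation. -/
lemma isMarkovChain_comp {Ω α β γ : Type*} [MeasurableSpace Ω] [MeasurableSpace α]
    [mβ : MeasurableSpace β] [MeasurableSpace γ] {μ : Measure Ω} [IsFiniteMeasure μ]
    {X : Ω → α} {Y : Ω → β} {T : β → γ} (hX : Measurable X) (hY : Measurable Y)
    (hT : Measurable T) : IsMarkovChain μ X Y (T ∘ Y) := by
  intro A B hA hB
  have hBm : MeasurableSet[mβ.comap Y] ((T ∘ Y) ⁻¹' B) := ⟨T ⁻¹' B, hT hB, rfl⟩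
  have hB' : MeasurableSet ((T ∘ Y) ⁻¹' B) := hY.comap_le _ hBm
  have hg : StronglyMeasurable[mβ.comap Y] (((T ∘ Y) ⁻¹' B).indicator fun _ => (1 : ℝ)) :=
    stronglyMeasurable_const.indicator hBm
  have hgi : Integrable (((T ∘ Y) ⁻¹' B).indicator fun _ => (1 : ℝ)) μ :=
    (integrable_const 1).indicator hB'
  have hfi : Integrable ((X ⁻¹' A).indicator fun _ => (1 : ℝ)) μ :=
    (integrable_const 1).indicator (hX hA)
  have hmul : ((X ⁻¹' A ∩ (T ∘ Y) ⁻¹' B).indicator fun _ => (1 : ℝ))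
      = ((X ⁻¹' A).indicator fun _ => (1 : ℝ)) * (((T ∘ Y) ⁻¹' B).indicator fun _ => (1 : ℝ)) := by
    funext ω
    simp only [Pi.mul_apply, ← Set.inter_indicator_mul, mul_one]
  have hfgi : Integrable (((X ⁻¹' A).indicator fun _ => (1 : ℝ))
      * (((T ∘ Y) ⁻¹' B).indicator fun _ => (1 : ℝ))) μ := by
    rw [← hmul]
    exact (integrable_const 1).indicator ((hX hA).inter hB')
  rw [hmul, condExp_of_stronglyMeasurable hY.comap_le hg hgi]
  exact condExp_mul_of_stronglyMeasurable_right hg hfgi hfi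

/-- Data processing inequality for mutual information. -/
lemma mutualInfo_comp_right_le {Ω α β γ : Type*} [MeasurableSpace Ω] [MeasurableSpace α]
    [MeasurableSpace β] [MeasurableSpace γ] {μ : Measure Ω} [IsFiniteMeasure μ]
    {X : Ω → α} {Y : Ω → β} {T : β → γ} (hX : Measurable X) (hY : Measurable Y)
    (hT : Measurable T) : mutualInfo μ X (T ∘ Y) ≤ mutualInfo μ X Y := by
  have hidT : Measurable (Prod.map (id : α → α) T) := measurable_id.prodMap hT
  have h1 : μ.map (fun ω => (X ω, (T ∘ Y) ω))
      = (μ.map fun ω => (X ω, Y ω)).map (Prod.map id T) :=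
    (Measure.map_map hidT (hX.prodMk hY)).symm
  have h2 : (μ.map X).prod (μ.map (T ∘ Y)) = ((μ.map X).prod (μ.map Y)).map (Prod.map id T) := by
    rw [← Measure.map_prod_map _ _ measurable_id hT, Measure.map_id, Measure.map_map hT hY]
  rw [mutualInfo, mutualInfo, h1, h2]
  exact klDiv_map_le _ _ hidT

/-! ### Change of measure -/

namespace InformationTheory

/-- Fenchel–Young: `y ↦ exp y - 1` is the convex conjugate of `klFun`, where `klFun x = x log x + 1
- x`. For `x > 0` it is `z + 1 ≤ exp z` at `z = y - log x`. -/
lemma mul_le_klFun_add_exp {x : ℝ} (hx : 0 ≤ x) (y : ℝ) :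
    x * y ≤ klFun x + Real.exp y - 1 := by
  rcases hx.eq_or_lt with rfl | hx
  · simp [klFun_zero, Real.exp_nonneg]
  · have h := Real.add_one_le_exp (y - Real.log x)
    rw [Real.exp_sub, Real.exp_log hx, le_div_iff₀ hx] at h
    rw [klFun_apply]
    linarith

variable {α : Type*} [MeasurableSpace α] {P Q : Measure α}

/-- A function with exponential moments under `Q` is integrable under every `P` of finite relative
entropy. -/
lemma integrable_of_klDiv_ne_top [IsFiniteMeasure P] [IsFiniteMeasure Q] (h : klDiv P Q ≠ ∞)
    {f : α → ℝ} (hf : AEStronglyMeasurable f Q) (hexp : Integrable (fun x => Real.exp (f x)) Q)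
    (hexp' : Integrable (fun x => Real.exp (-f x)) Q) : Integrable f P := by
  obtain ⟨hac, hllr⟩ := klDiv_ne_top_iff.1 h
  have hkl := (integrable_klFun_rnDeriv_iff hac).2 hllr
  rw [← integrable_rnDeriv_smul_iff hac]
  refine ((hkl.add hexp).add hexp').mono'
    ((Measure.measurable_rnDeriv P Q).ennreal_toReal.aestronglyMeasurable.smul hf)
    (ae_of_all _ fun x => ?_)
  have h0 : 0 ≤ (P.rnDeriv Q x).toReal := ENNReal.toReal_nonneg
  -- Young's inequality at `f x` and at `-f x` dominates the absolute value of density times `f`.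
  have h1 := mul_le_klFun_add_exp h0 (f x)
  have h2 := mul_le_klFun_add_exp h0 (-f x)
  have h3 := Real.exp_pos (f x)
  have h4 := Real.exp_pos (-f x)
  rw [Real.norm_eq_abs, smul_eq_mul, abs_le]
  simp only [Pi.add_apply]
  constructor <;> linarith

/-- Young's inequality with `x` the density of `P`, integrated against `Q`. It is weaker than
Donsker–Varadhan, which follows by shifting `f` by a constant. -/
lemma integral_le_toReal_klDiv_add_integral_exp [IsFiniteMeasure P] [IsProbabilityMeasure Q]
    (h : klDiv P Q ≠ ∞) {f : α → ℝ} (hf : Integrable f P)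
    (hexp : Integrable (fun x => Real.exp (f x)) Q) :
    ∫ x, f x ∂P ≤ (klDiv P Q).toReal + ∫ x, Real.exp (f x) ∂Q - 1 := by
  obtain ⟨hac, hllr⟩ := klDiv_ne_top_iff.1 h
  have hkl := (integrable_klFun_rnDeriv_iff hac).2 hllr
  calc ∫ x, f x ∂P = ∫ x, (P.rnDeriv Q x).toReal • f x ∂Q := (integral_rnDeriv_smul hac).symm
    _ ≤ ∫ x, (klFun (P.rnDeriv Q x).toReal + Real.exp (f x) - 1) ∂Q :=
        integral_mono ((integrable_rnDeriv_smul_iff hac).2 hf)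
          ((hkl.add hexp).sub (integrable_const 1))
          fun x => mul_le_klFun_add_exp ENNReal.toReal_nonneg (f x)
    _ = _ := by
        rw [integral_sub (by exact hkl.add hexp) (integrable_const 1), integral_add hkl hexp,
          toReal_klDiv_eq_integral_klFun hac]
        simp

/-- The Donsker–Varadhan inequality. -/
lemma integral_le_toReal_klDiv_add_log [IsProbabilityMeasure P] [IsProbabilityMeasure Q]
    (h : klDiv P Q ≠ ∞) {f : α → ℝ} (hf : Integrable f P)
    (hexp : Integrable (fun x => Real.exp (f x)) Q) :
    ∫ x, f x ∂P ≤ (klDiv P Q).toReal + Real.log (∫ x, Real.exp (f x) ∂Q) := by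
  set Z := ∫ x, Real.exp (f x) ∂Q with hZ
  have hZpos : 0 < Z := integral_exp_pos hexp
  have hshift (x : α) : Real.exp (f x - Real.log Z) = Real.exp (f x) / Z := by
    rw [Real.exp_sub, Real.exp_log hZpos]
  -- Subtracting `log Z` normalises the exponential integral to `1`, cancelling the `- 1`.
  have key := integral_le_toReal_klDiv_add_integral_exp h
    (f := fun x => f x - Real.log Z) (hf.sub (integrable_const _))
    (by simpa only [hshift] using hexp.div_const Z)
  simp only [hshift] at key
  rw [integral_sub hf (integrable_const _), integral_div, ← hZ, div_self hZpos.ne'] at key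
  simp only [integral_const, probReal_univ, one_smul] at key
  linarith

end InformationTheory

namespace ProbabilityTheory.HasSubgaussianMGF

variable {α : Type*} [MeasurableSpace α] {P Q : Measure α} {f : α → ℝ} {c : ℝ≥0}

lemma integrable_of_klDiv_ne_top [IsFiniteMeasure P] [IsFiniteMeasure Q]
    (hf : HasSubgaussianMGF f c Q) (h : klDiv P Q ≠ ∞) : Integrable f P :=
  InformationTheory.integrable_of_klDiv_ne_top h hf.aestronglyMeasurable
    (by simpa using hf.integrable_exp_mul 1) (by simpa using hf.integrable_exp_mul (-1))

/-- Donsker–Varadhan for `t * f` makes a quadratic in `t` nonnegative everywhere; its discriminant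
is then at most `0`. Both signs of the mean are covered at once, and `c = 0` needs no separate case.
-/
lemma sq_integral_le_klDiv [IsProbabilityMeasure P] [IsProbabilityMeasure Q]
    (hf : HasSubgaussianMGF f c Q) (h : klDiv P Q ≠ ∞) :
    (∫ x, f x ∂P) ^ 2 ≤ 2 * c * (klDiv P Q).toReal := by
  have hfi := hf.integrable_of_klDiv_ne_top h
  have key (t : ℝ) :
      0 ≤ (c / 2 : ℝ) * (t * t) + -(∫ x, f x ∂P) * t + (klDiv P Q).toReal := by
    have h1 := integral_le_toReal_klDiv_add_log h (hfi.const_mul t) (hf.integrable_exp_mul t)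
    have h2 : Real.log (∫ x, Real.exp (t * f x) ∂Q) ≤ c * t ^ 2 / 2 := hf.cgf_le t
    rw [integral_const_mul] at h1
    linarith
  have := discrim_le_zero key
  rw [discrim] at this
  linarith

/-- A function on a product space all of whose sections are sub-Gaussian is sub-Gaussian. -/
lemma prod {β : Type*} [MeasurableSpace β] {ν : Measure β} [IsProbabilityMeasure Q]
    [IsProbabilityMeasure ν] {g : α × β → ℝ} (hg : Measurable g)
    (h : ∀ b, HasSubgaussianMGF (fun a => g (a, b)) c Q) : HasSubgaussianMGF g c (Q.prod ν) := by
  have hle (t : ℝ) (b : β) : ∫ a, Real.exp (t * g (a, b)) ∂Q ≤ Real.exp (c * t ^ 2 / 2) :=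
    (h b).mgf_le t
  have hmeas (t : ℝ) : Measurable fun p => Real.exp (t * g p) := (hg.const_mul t).exp
  have hint (t : ℝ) : Integrable (fun b => ∫ a, Real.exp (t * g (a, b)) ∂Q) ν := by
    refine (integrable_const (Real.exp (c * t ^ 2 / 2))).mono'
      (hmeas t).stronglyMeasurable.integral_prod_left'.aestronglyMeasurable
      (ae_of_all _ fun b => ?_)
    rw [Real.norm_of_nonneg (integral_nonneg fun _ => (Real.exp_pos _).le)]
    exact hle t b
  have hint' (t : ℝ) : Integrable (fun p => Real.exp (t * g p)) (Q.prod ν) := by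
    -- The sub-Gaussian bound is uniform in `b`, so Tonelli yields integrability on the product.
    rw [integrable_prod_iff' (hmeas t).aestronglyMeasurable]
    refine ⟨ae_of_all _ fun b => (h b).integrable_exp_mul t, ?_⟩
    simpa only [Real.norm_of_nonneg (Real.exp_pos _).le] using hint t
  refine ⟨hint', fun t => ?_⟩
  calc mgf g (Q.prod ν) t = ∫ b, ∫ a, Real.exp (t * g (a, b)) ∂Q ∂ν :=
        integral_prod_symm _ (hint' t)
    _ ≤ ∫ _, Real.exp (c * t ^ 2 / 2) ∂ν :=
        integral_mono (hint t) (integrable_const _) (hle t)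
    _ = Real.exp (c * t ^ 2 / 2) := by simp

/-- The average of `n` independent copies of a sub-Gaussian variable. -/
lemma pi_average {c : ℝ≥0} [IsProbabilityMeasure Q] (hf : HasSubgaussianMGF f c Q) {n : ℕ}
    (hn : 0 < n) :
    HasSubgaussianMGF (fun s : Fin n → α => (∑ i, f (s i)) / n) (c / n)
      (Measure.pi fun _ => Q) := by
  have hindep : iIndepFun (fun (i : Fin n) (s : Fin n → α) => f (s i)) (Measure.pi fun _ => Q) :=
    iIndepFun_pi fun _ => hf.aemeasurable
  have hi (i : Fin n) :
      HasSubgaussianMGF (fun s : Fin n → α => f (s i)) c (Measure.pi fun _ => Q) := by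
    have hev := measurePreserving_eval (fun _ : Fin n => Q) i
    exact of_map (Y := Function.eval i) hev.measurable.aemeasurable (by rwa [hev.map_eq])
  have hsum := (sum_of_iIndepFun hindep (s := Finset.univ) fun i _ => hi i).const_mul (n : ℝ)⁻¹
  have hn' : (n : ℝ) ≠ 0 := by exact_mod_cast hn.ne'
  convert hsum using 1
  · funext s
    rw [div_eq_inv_mul]
  · refine NNReal.eq ?_
    -- Independent proxies add up to `n c`, and scaling by `1 / n` multiplies by `1 / n²`.
    change (c / n : ℝ) = (n : ℝ)⁻¹ ^ 2 * ((∑ _ : Fin n, c : ℝ≥0) : ℝ)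
    simp only [Finset.sum_const, Finset.card_univ, Fintype.card_fin, nsmul_eq_mul,
      NNReal.coe_mul, NNReal.coe_natCast]
    field_simp

end ProbabilityTheory.HasSubgaussianMGF

/-! ### The generalization gap -/

lemma infoBound_mono (σ : ℝ≥0) (n : ℕ) : Monotone (infoBound σ n) := fun _ _ h =>
  ENNReal.rpow_le_rpow (mul_le_mul_right h _) (by norm_num)

lemma infoBound_top {σ : ℝ≥0} (hσ : 0 < σ) {n : ℕ} (hn : 0 < n) : infoBound σ n ∞ = ∞ := by
  -- The factor must be nonzero because `0 * ∞ = 0` in `ℝ≥0∞`.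
  have hc : ((2 * σ ^ 2 / n : ℝ≥0) : ℝ≥0∞) ≠ 0 := by
    rw [ENNReal.coe_ne_zero]
    positivity
  rw [infoBound, ENNReal.mul_top hc, ENNReal.top_rpow_of_pos (by norm_num)]

lemma ofReal_abs_le_infoBound {σ : ℝ≥0} {n : ℕ} {I : ℝ≥0∞} {x : ℝ}
    (hx : x ^ 2 ≤ 2 * ((σ ^ 2 / n : ℝ≥0) : ℝ) * I.toReal) :
    ENNReal.ofReal |x| ≤ infoBound σ n I := by
  rw [infoBound, one_div, ENNReal.le_rpow_inv_iff (by norm_num : (0 : ℝ) < 2)]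
  rw [ENNReal.ofReal_rpow_of_nonneg (abs_nonneg x) (by norm_num), Real.rpow_two, sq_abs]
  refine ENNReal.ofReal_le_of_le_toReal (hx.trans_eq ?_)
  rw [ENNReal.toReal_mul, ENNReal.coe_toReal]
  push_cast
  ring

section GeneralizationGap

variable {F 𝒳 𝒴 Θ Ω : Type*} [MeasurableSpace 𝒳] [MeasurableSpace 𝒴] [MeasurableSpace Θ]
  [MeasurableSpace Ω] {μ : Measure Ω} [IsProbabilityMeasure μ] {D : Measure (𝒳 × 𝒴)}
  [IsProbabilityMeasure D] {loss : F → 𝒳 → 𝒴 → ℝ} {f : Θ → F} {n : ℕ}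
  {S : Ω → Fin n → 𝒳 × 𝒴} {W : Ω → Θ} {σ : ℝ≥0}

lemma measurable_empRisk_sub_risk
    (hm : Measurable fun p : Θ × (𝒳 × 𝒴) => loss (f p.1) p.2.1 p.2.2) :
    Measurable fun p : (Fin n → 𝒳 × 𝒴) × Θ =>
      empRisk loss p.1 (f p.2) - risk loss D (f p.2) := by
  have hemp : Measurable fun p : (Fin n → 𝒳 × 𝒴) × Θ => empRisk loss p.1 (f p.2) := by
    refine (Finset.measurable_sum _ fun i _ => ?_).div_const _
    exact hm.comp (measurable_snd.prodMk ((measurable_pi_apply i).comp measurable_fst))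
  have hrisk : Measurable fun θ : Θ => risk loss D (f θ) :=
    hm.stronglyMeasurable.integral_prod_right'.measurable
  exact hemp.sub (hrisk.comp measurable_snd)

/-- With an independent parameter, the generalization gap is sub-Gaussian with variance proxy
`σ² / n`. -/
lemma hasSubgaussianMGF_empRisk_sub_risk (hn : 0 < n) {ν : Measure Θ} [IsProbabilityMeasure ν]
    (hm : Measurable fun p : Θ × (𝒳 × 𝒴) => loss (f p.1) p.2.1 p.2.2)
    (hsub : ∀ θ, HasSubgaussianMGF
      (fun z => loss (f θ) z.1 z.2 - risk loss D (f θ)) (σ ^ 2) D) :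
    HasSubgaussianMGF (fun p : (Fin n → 𝒳 × 𝒴) × Θ =>
      empRisk loss p.1 (f p.2) - risk loss D (f p.2)) (σ ^ 2 / n)
      ((Measure.pi fun _ => D).prod ν) := by
  refine HasSubgaussianMGF.prod (measurable_empRisk_sub_risk hm) fun θ => ?_
  have hn' : (n : ℝ) ≠ 0 := by exact_mod_cast hn.ne'
  convert (hsub θ).pi_average hn using 2 with s
  rw [empRisk, Finset.sum_sub_distrib, sub_div]
  simp [hn']

lemma integrable_empRisk_sub_risk (hn : 0 < n) (hS : Measurable S)
    (hS_law : μ.map S = Measure.pi fun _ => D) (hW : Measurable W)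
    (hm : Measurable fun p : Θ × (𝒳 × 𝒴) => loss (f p.1) p.2.1 p.2.2)
    (hsub : ∀ θ, HasSubgaussianMGF
      (fun z => loss (f θ) z.1 z.2 - risk loss D (f θ)) (σ ^ 2) D)
    (hI : mutualInfo μ S W ≠ ∞) :
    Integrable (fun ω => empRisk loss (S ω) (f (W ω)) - risk loss D (f (W ω))) μ := by
  have hSW : Measurable fun ω => (S ω, W ω) := hS.prodMk hW
  have := Measure.isProbabilityMeasure_map (μ := μ) hSW.aemeasurable
  have := Measure.isProbabilityMeasure_map (μ := μ) hW.aemeasurable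
  rw [mutualInfo, hS_law] at hI
  exact ((hasSubgaussianMGF_empRisk_sub_risk hn hm hsub).integrable_of_klDiv_ne_top
    hI).comp_measurable hSW

/-- The mutual information bound on the expected generalization gap. -/
lemma abs_integral_empRisk_sub_risk_le (hn : 0 < n) (hσ : 0 < σ) (hS : Measurable S)
    (hS_law : μ.map S = Measure.pi fun _ => D) (hW : Measurable W)
    (hm : Measurable fun p : Θ × (𝒳 × 𝒴) => loss (f p.1) p.2.1 p.2.2)
    (hsub : ∀ θ, HasSubgaussianMGF
      (fun z => loss (f θ) z.1 z.2 - risk loss D (f θ)) (σ ^ 2) D) :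
    ENNReal.ofReal |∫ ω, (empRisk loss (S ω) (f (W ω)) - risk loss D (f (W ω))) ∂μ|
      ≤ infoBound σ n (mutualInfo μ S W) := by
  rcases eq_or_ne (mutualInfo μ S W) ∞ with hI | hI
  · rw [hI, infoBound_top hσ hn]
    exact le_top
  have hSW : Measurable fun ω => (S ω, W ω) := hS.prodMk hW
  have := Measure.isProbabilityMeasure_map (μ := μ) hSW.aemeasurable
  have := Measure.isProbabilityMeasure_map (μ := μ) hW.aemeasurable
  refine ofReal_abs_le_infoBound ?_
  -- The reference measure becomes `Dⁿ` times the law of `W`, where the gap is sub-Gaussian.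
  rw [mutualInfo, hS_law] at hI ⊢
  rw [← integral_map (φ := fun ω => (S ω, W ω)) hSW.aemeasurable
    (f := fun p => empRisk loss p.1 (f p.2) - risk loss D (f p.2))
    (measurable_empRisk_sub_risk hm).aestronglyMeasurable]
  exact (hasSubgaussianMGF_empRisk_sub_risk hn hm hsub).sq_integral_le_klDiv hI

end GeneralizationGap

theorem mainTheorem2
    {V M : Type*} [Fintype M] [DecidableEq M] {δ : M → ℕ} {d L k o : ℕ}
    {Ψ : Type*} [MeasurableSpace Ψ]
    {𝒳 𝒴 : Type*} [MeasurableSpace 𝒳] [MeasurableSpace 𝒴]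
    {Ω : Type*} [MeasurableSpace Ω] (μ : Measure Ω) [IsProbabilityMeasure μ]
    -- the two networks
    (gnn : GNNArch V M d L k o Ψ) (nsg : NSGArch V M d L k o Ψ)
    -- the data distribution and the i.i.d. training sample
    (D : Measure (𝒳 × 𝒴)) [IsProbabilityMeasure D]
    {n : ℕ} (hn : 0 < n) (S : Ω → Fin n → 𝒳 × 𝒴) (hS : Measurable S)
    (hS_law : μ.map S = Measure.pi fun _ => D)
    -- the loss is measurable and sub-Gaussian for both networks
    (loss : Predictor V M δ o → 𝒳 → 𝒴 → ℝ) (σ : ℝ≥0) (hσ : 0 < σ)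
    (hm_gnn : Measurable fun p : gnnParamSpace M δ d L k Ψ × (𝒳 × 𝒴) =>
      loss (gnn.predict p.1.1) p.2.1 p.2.2)
    (hm_nsg : Measurable fun p : nsgParamSpace M δ d L k Ψ × (𝒳 × 𝒴) =>
      loss (nsg.predict p.1.1) p.2.1 p.2.2)
    (hsub_gnn : ∀ θ ∈ gnnParamSpace M δ d L k Ψ,
      HasSubgaussianMGF
        (fun z => loss (gnn.predict θ) z.1 z.2 - risk loss D (gnn.predict θ)) (σ ^ 2) D)
    (hsub_nsg : ∀ θ ∈ nsgParamSpace M δ d L k Ψ,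
      HasSubgaussianMGF
        (fun z => loss (nsg.predict θ) z.1 z.2 - risk loss D (nsg.predict θ)) (σ ^ 2) D) :
    -- the NSG parameter space is a measurable image (a retract) of the GNN parameter space
    (∃ (hsubset : nsgParamSpace M δ d L k Ψ ⊆ gnnParamSpace M δ d L k Ψ)
      (T : gnnParamSpace M δ d L k Ψ → nsgParamSpace M δ d L k Ψ),
      Measurable T ∧ (∀ w, T (Set.inclusion hsubset w) = w) ∧
      ∀ W_NSG : Ω → nsgParamSpace M δ d L k Ψ, Measurable W_NSG →
        ∃ W_GNN : Ω → gnnParamSpace M δ d L k Ψ, Measurable W_GNN ∧ W_NSG = T ∘ W_GNN) ∧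
    -- comparison of the two models
    (∀ (W_GNN : Ω → gnnParamSpace M δ d L k Ψ)
      (T : gnnParamSpace M δ d L k Ψ → nsgParamSpace M δ d L k Ψ)
      (W_NSG : Ω → nsgParamSpace M δ d L k Ψ),
      Measurable W_GNN → Measurable T → W_NSG = T ∘ W_GNN →
      IsMarkovChain μ S W_GNN W_NSG ∧
      mutualInfo μ S W_NSG ≤ mutualInfo μ S W_GNN ∧
      (mutualInfo μ S W_GNN ≠ ∞ →
        Integrable (fun ω => empRisk loss (S ω) (gnn.predict (W_GNN ω).1)
          - risk loss D (gnn.predict (W_GNN ω).1)) μ) ∧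
      (mutualInfo μ S W_NSG ≠ ∞ →
        Integrable (fun ω => empRisk loss (S ω) (nsg.predict (W_NSG ω).1)
          - risk loss D (nsg.predict (W_NSG ω).1)) μ) ∧
      ENNReal.ofReal |∫ ω, (empRisk loss (S ω) (gnn.predict (W_GNN ω).1)
          - risk loss D (gnn.predict (W_GNN ω).1)) ∂μ|
        ≤ infoBound σ n (mutualInfo μ S W_GNN) ∧
      ENNReal.ofReal |∫ ω, (empRisk loss (S ω) (nsg.predict (W_NSG ω).1)
          - risk loss D (nsg.predict (W_NSG ω).1)) ∂μ|
        ≤ infoBound σ n (mutualInfo μ S W_NSG) ∧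
      infoBound σ n (mutualInfo μ S W_NSG) ≤ infoBound σ n (mutualInfo μ S W_GNN)) := by
  have hsubset : nsgParamSpace M δ d L k Ψ ⊆ gnnParamSpace M δ d L k Ψ := Set.subset_univ _
  refine ⟨⟨hsubset, blockProjection M δ d L k Ψ, measurable_blockProjection M δ d L k Ψ,
    -- The random GNN parameter is `W` itself, since the projection fixes block diagonal parameters.
    blockProjection_inclusion hsubset, fun W hW => ⟨Set.inclusion hsubset ∘ W,
      (measurable_inclusion hsubset).comp hW,
      funext fun ω => (blockProjection_inclusion hsubset (W ω)).symm⟩⟩, ?_⟩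
  rintro W T _ hW hT rfl
  have hsub_gnn' (θ : gnnParamSpace M δ d L k Ψ) := hsub_gnn θ.1 θ.2
  have hsub_nsg' (θ : nsgParamSpace M δ d L k Ψ) := hsub_nsg θ.1 θ.2
  have hle : mutualInfo μ S (T ∘ W) ≤ mutualInfo μ S W := mutualInfo_comp_right_le hS hW hT
  exact ⟨isMarkovChain_comp hS hW hT, hle,
    integrable_empRisk_sub_risk (f := fun θ : gnnParamSpace M δ d L k Ψ => gnn.predict θ.1)
      hn hS hS_law hW hm_gnn hsub_gnn',
    integrable_empRisk_sub_risk (f := fun θ : nsgParamSpace M δ d L k Ψ => nsg.predict θ.1)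
      hn hS hS_law (hT.comp hW) hm_nsg hsub_nsg',
    abs_integral_empRisk_sub_risk_le (f := fun θ : gnnParamSpace M δ d L k Ψ => gnn.predict θ.1)
      hn hσ hS hS_law hW hm_gnn hsub_gnn',
    abs_integral_empRisk_sub_risk_le (f := fun θ : nsgParamSpace M δ d L k Ψ => nsg.predict θ.1)
      hn hσ hS hS_law (hT.comp hW) hm_nsg hsub_nsg',
    infoBound_mono σ n hle⟩
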